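/- Let $k$ be an algebraically closed field of positive characteristic $p$, and let $\mathbb{G}_a$ be the additive group of $k$. A representation $u:\mathbb{G}_a\to\mathrm{SL}(3,k)$ of algebraic groups is called *fundamental* if there is a representation (of algebraic groups) $\psi:\mathrm{SL}(2,k)\to\mathrm{SL}(3,k)$ with $\psi\begin{pmatrix}1&t\\0&1\end{pmatrix}=u(t)$ for all $t\in k$. Two representations $u,v:\mathbb{G}_a\to\mathrm{SL}(3,k)$ are *equivalent*, $u\sim v$, if there is $P\in\mathrm{GL}(3,k)$ with $P^{-1}u(t)P=v(t)$ for all $t\in k$. (1) If $p=2$, there is a one-to-one correspondence $$\{u:\mathbb{G}_a\to\mathrm{SL}(3,k)\mid u\text{ is fundamental}\}/\!\sim\;\;\cong\;\;\mathbb{Z}_{\ge0}\amalg\mathbb{Z}_{\ge0}\amalg\mathbb{Z}_{\ge0}\amalg\{I_3\},$$ under which $e$ in the first, second and third copy of $\mathbb{Z}_{\ge0}$ and $I_3$ correspond, respectively, to the classes of the fundamental representations $$t\mapsto\begin{pmatrix}1&0&t^{p^e}\\0&1&0\\0&0&1\end{pmatrix},\quad t\mapsto\begin{pmatrix}1&t^{p^e}&t^{2p^e}\\0&1&0\\0&0&1\end{pmatrix},\quad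 t\mapsto\begin{pmatrix}1&0&t^{2p^e}\\0&1&t^{p^e}\\0&0&1\end{pmatrix},\quad t\mapsto I_3.$$ (2) If $p\ge3$, there is a one-to-one correspondence $$\{u:\mathbb{G}_a\to\mathrm{SL}(3,k)\mid u\text{ is fundamental}\}/\!\sim\;\;\cong\;\;\mathbb{Z}_{\ge0}\amalg\mathbb{Z}_{\ge0}\amalg\{I_3\},$$ under which $e$ in the first and second copy of $\mathbb{Z}_{\ge0}$ and $I_3$ correspond, respectively, to the classes of the fundamental representations $$t\mapsto\begin{pmatrix}1&t^{p^e}&\tfrac12t^{2p^e}\\0&1&t^{p^e}\\0&0&1\end{pmatrix},\quad t\mapsto\begin{pmatrix}1&0&t^{p^e}\\0&1&0\\0&0&1\end{pmatrix},\quad t\mapsto I_3.$$ -/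

import Mathlib

namespace GaSL

open Matrix

/-- A representation `u : G_a → SL(n, k)` of the additive group `G_a = k` as an algebraic group
(over an algebraically closed field, described on `k`-points): a group homomorphism all of whose
matrix entries are polynomial functions on the affine line. -/
structure GaRep (k : Type*) [Field k] (n : ℕ) where
  toFun : k → SpecialLinearGroup (Fin n) k
  map_add : ∀ s t : k, toFun (s + t) = toFun s * toFun t
  regular : ∀ i j : Fin n, ∃ f : Polynomial k, ∀ t : k,
    (toFun t : Matrix (Fin n) (Fin n) k) i j = f.eval t

/-- A representation `ψ : SL(2, k) → SL(n, k)` of the algebraic group `SL(2, k)`: a group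
homomorphism all of whose matrix entries are regular functions on the affine variety `SL(2, k)`,
i.e. restrictions of polynomials in the four matrix entries. -/
structure SL2Rep (k : Type*) [Field k] (n : ℕ) where
  toHom : SpecialLinearGroup (Fin 2) k →* SpecialLinearGroup (Fin n) k
  regular : ∀ i j : Fin n, ∃ f : MvPolynomial (Fin 2 × Fin 2) k,
    ∀ g : SpecialLinearGroup (Fin 2) k,
      (toHom g : Matrix (Fin n) (Fin n) k) i j
        = MvPolynomial.eval (fun ab => (g : Matrix (Fin 2) (Fin 2) k) ab.1 ab.2) f

/-- The inclusion `ι⁺ : G_a → SL(2, k)`. -/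
def iotaPlus {k : Type*} [Field k] (t : k) : SpecialLinearGroup (Fin 2) k :=
  ⟨!![1, t; 0, 1], by simp [Matrix.det_fin_two_of]⟩

/-- `u : G_a → SL(n, k)` is fundamental if it extends to a representation of `SL(2, k)`. -/
def GaRep.IsFundamental {k : Type*} [Field k] {n : ℕ} (u : GaRep k n) : Prop :=
  ∃ ψ : SL2Rep k n, ∀ t : k, ψ.toHom (iotaPlus t) = u.toFun t

/-- `u` and `v` are equivalent if `P⁻¹ u(t) P = v(t)` for all `t`, for some `P ∈ GL(n, k)`. -/
def GaRep.Equivalent {k : Type*} [Field k] {n : ℕ} (u v : GaRep k n) : Prop :=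
  ∃ P : GL (Fin n) k, ∀ t : k,
    ((P⁻¹ : GL (Fin n) k) : Matrix (Fin n) (Fin n) k) * (u.toFun t : Matrix (Fin n) (Fin n) k)
      * (P : Matrix (Fin n) (Fin n) k) = (v.toFun t : Matrix (Fin n) (Fin n) k)

theorem GaRep.equivalent_equivalence (k : Type*) [Field k] (n : ℕ) :
    Equivalence (GaRep.Equivalent (k := k) (n := n)) where
  refl u := ⟨1, fun t => by simp⟩
  symm := by
    rintro u v ⟨P, hP⟩
    refine ⟨P⁻¹, fun t => ?_⟩
    rw [← hP t, inv_inv]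
    simp only [Matrix.mul_assoc, Units.mul_inv, Units.mul_inv_cancel_left, Matrix.mul_one]
  trans := by
    rintro u v w ⟨P, hP⟩ ⟨Q, hQ⟩
    refine ⟨P * Q, fun t => ?_⟩
    rw [← hQ t, ← hP t, _root_.mul_inv_rev]
    simp only [Units.val_mul, Matrix.mul_assoc]

/-- The set of fundamental representations `G_a → SL(n, k)`. -/
abbrev FundamentalGaRep (k : Type*) [Field k] (n : ℕ) : Type _ :=
  {u : GaRep k n // u.IsFundamental}

/-- Equivalence of representations, as a setoid on the fundamental ones. -/
def fundamentalSetoid (k : Type*) [Field k] (n : ℕ) : Setoid (FundamentalGaRep k n) where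
  r u v := u.1.Equivalent v.1
  iseqv := (GaRep.equivalent_equivalence k n).comap Subtype.val

/-- The set of fundamental representations `G_a → SL(n, k)` up to equivalence. -/
abbrev FundamentalClasses (k : Type*) [Field k] (n : ℕ) : Type _ :=
  Quotient (fundamentalSetoid k n)

/-- The equivalence class of a fundamental representation. -/
def fundamentalClass {k : Type*} [Field k] {n : ℕ} (u : FundamentalGaRep k n) :
    FundamentalClasses k n :=
  Quotient.mk (fundamentalSetoid k n) u

/-- The fundamental representation `u` is the map `t ↦ M t`. -/
def HasForm {k : Type*} [Field k] {n : ℕ} (u : FundamentalGaRep k n)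
    (M : k → Matrix (Fin n) (Fin n) k) : Prop :=
  ∀ t : k, (u.1.toFun t : Matrix (Fin n) (Fin n) k) = M t

/-- The one-point set `{I_n}`. -/
abbrev OnlyId (k : Type*) [Field k] (n : ℕ) : Type _ :=
  ({1} : Set (SpecialLinearGroup (Fin n) k))

end GaSL

/-! Every listed form occurs: it is the restriction to upper unipotent matrices of a Frobenius twist
of the trivial representation, of standard plus trivial, or of the symmetric square (in
characteristic two also of its dual).

Conversely, let `ψ` extend `u`. The diagonal torus acts diagonalizably with integral weights
(`exists_weight_basis`). Determinant one and the Weyl element force them to be `m, 0, -m`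
(`exists_torus_basis`). Conjugating `u(t)` by the torus element of `a` gives `u(a²t)`, so in a
weight basis each entry of `u` is a constant times a power of `t` whose exponent is half a
difference of weights, and is zero if that half is negative or not an integer. Hence `u` is
conjugate to some `unip α β γ n m` (`conj_unip`). Additivity of `u` makes the relevant exponent a
power of `p` and, when `α` or `γ` is nonzero, gives `2β = αγ`. Thus `αγ = 0` in characteristic two,
while otherwise `β` is determined by `αγ`. Rescaling and permuting the basis leaves the listed forms
(`conj_forms`).

The forms are inequivalent because the span of the matrix entries is a conjugacy invariant, and the
powers of `t` in it (`exponents`) recover `e` and the type. Only the symmetric square and its dual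
share their exponents; their fixed row vectors separate them. -/

namespace GaSL

open Matrix

/-! ### Explicit representations of `SL(2, k)` and their Frobenius twists -/

noncomputable section Constructions

variable {k : Type*} [Field k] {n : ℕ}

theorem coe_iotaPlus (t : k) : (iotaPlus t : Matrix (Fin 2) (Fin 2) k) = !![1, t; 0, 1] := rfl

theorem iotaPlus_add (s t : k) : iotaPlus (s + t) = iotaPlus s * iotaPlus t := by
  ext i j
  fin_cases i <;> fin_cases j <;>
    simp [coe_iotaPlus, Matrix.mul_apply, Fin.sum_univ_two, add_comm]

/-- The restriction of a representation of `SL(2, k)` along `ι⁺`. -/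
def SL2Rep.restrict (ψ : SL2Rep k n) : GaRep k n where
  toFun t := ψ.toHom (iotaPlus t)
  map_add s t := by rw [iotaPlus_add, map_mul]
  regular i j := by
    obtain ⟨f, hf⟩ := ψ.regular i j
    refine ⟨MvPolynomial.eval₂ Polynomial.C
      (fun ab => (!![1, Polynomial.X; 0, 1] : Matrix (Fin 2) (Fin 2) (Polynomial k)) ab.1 ab.2) f,
      fun t => ?_⟩
    rw [hf, ← Polynomial.coe_evalRingHom, MvPolynomial.hom_eval₂, MvPolynomial.eval,
      MvPolynomial.coe_eval₂Hom]
    congr 1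
    · ext; simp
    · ext ⟨a, b⟩
      fin_cases a <;> fin_cases b <;> simp [coe_iotaPlus]

/-- The restriction of `ψ`, as a fundamental representation. -/
def SL2Rep.fundamental (ψ : SL2Rep k n) : FundamentalGaRep k n :=
  ⟨ψ.restrict, ψ, fun _ => rfl⟩

theorem eval_expand {R σ : Type*} [CommRing R] (m : ℕ) (x : σ → R) (f : MvPolynomial σ R) :
    MvPolynomial.eval x (MvPolynomial.expand m f) = MvPolynomial.eval (fun i => x i ^ m) f := by
  induction f using MvPolynomial.induction_on with
  | C a => simp
  | add f g hf hg => simp [hf, hg]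
  | mul_X f i hf => simp [hf]

/-- The twist of a representation of `SL(2, k)` by the `e`-th power of Frobenius. -/
def SL2Rep.twist (ψ : SL2Rep k n) (p : ℕ) [ExpChar k p] (e : ℕ) : SL2Rep k n where
  toHom := ψ.toHom.comp (Matrix.SpecialLinearGroup.map (iterateFrobenius k p e))
  regular i j := by
    obtain ⟨f, hf⟩ := ψ.regular i j
    exact ⟨MvPolynomial.expand (p ^ e) f, fun g => by
      rw [eval_expand, MonoidHom.comp_apply, hf]
      simp [iterateFrobenius_def]⟩

theorem SL2Rep.twist_fundamental_apply (ψ : SL2Rep k n) (p : ℕ) [ExpChar k p] (e : ℕ) (t : k) :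
    (ψ.twist p e).fundamental.1.toFun t = ψ.toHom (iotaPlus (t ^ p ^ e)) := by
  change ψ.toHom (Matrix.SpecialLinearGroup.map (iterateFrobenius k p e) (iotaPlus t)) = _
  congr 1
  ext i j
  fin_cases i <;> fin_cases j <;> simp [coe_iotaPlus, iterateFrobenius_def, (expChar_pos k p).ne']

/-- A matrix of polynomials in the entries of `g ∈ SL(2, k)` that is multiplicative and has
determinant one defines a representation. -/
def SL2Rep.ofPolynomials
    (F : Matrix (Fin n) (Fin n) (MvPolynomial (Fin 2 × Fin 2) k))
    (ρ : SpecialLinearGroup (Fin 2) k → Matrix (Fin n) (Fin n) k)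
    (hF : ∀ g i j, ρ g i j =
      MvPolynomial.eval (fun ab => (g : Matrix (Fin 2) (Fin 2) k) ab.1 ab.2) (F i j))
    (hdet : ∀ g, (ρ g).det = 1) (hone : ρ 1 = 1) (hmul : ∀ g h, ρ (g * h) = ρ g * ρ h) :
    SL2Rep k n where
  toHom :=
    { toFun := fun g => ⟨ρ g, hdet g⟩
      map_one' := Subtype.ext hone
      map_mul' := fun g h => Subtype.ext (hmul g h) }
  regular i j := ⟨F i j, fun g => hF g i j⟩

theorem SL2Rep.ofPolynomials_apply {F ρ hF hdet hone hmul} (g : SpecialLinearGroup (Fin 2) k) :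
    ((SL2Rep.ofPolynomials (n := n) F ρ hF hdet hone hmul).toHom g : Matrix (Fin n) (Fin n) k)
      = ρ g := rfl

theorem SL2_det (g : SpecialLinearGroup (Fin 2) k) : g 0 0 * g 1 1 - g 0 1 * g 1 0 = 1 := by
  have := g.2
  rwa [Matrix.det_fin_two] at this

theorem SL2_mul_apply (g h : SpecialLinearGroup (Fin 2) k) (i j : Fin 2) :
    (g * h) i j = g i 0 * h 0 j + g i 1 * h 1 j := by
  rw [Matrix.SpecialLinearGroup.coe_mul, Matrix.mul_apply, Fin.sum_univ_two]

/-- The trivial representation. -/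
def trivialRep (k : Type*) [Field k] (n : ℕ) : SL2Rep k n where
  toHom := 1
  regular i j := ⟨MvPolynomial.C ((1 : Matrix (Fin n) (Fin n) k) i j), fun g => by simp⟩

open MvPolynomial in
/-- The direct sum of the standard and the trivial representation. -/
def stdRep (k : Type*) [Field k] : SL2Rep k 3 :=
  SL2Rep.ofPolynomials !![X (0, 0), 0, X (0, 1); 0, 1, 0; X (1, 0), 0, X (1, 1)]
    (fun g => !![g 0 0, 0, g 0 1; 0, 1, 0; g 1 0, 0, g 1 1])
    (fun g i j => by fin_cases i <;> fin_cases j <;> simp)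
    (fun g => by
      rw [Matrix.det_fin_three]
      simp
      linear_combination SL2_det g)
    (by ext i j; fin_cases i <;> fin_cases j <;> simp)
    (fun g h => by
      ext i j
      fin_cases i <;> fin_cases j <;> simp [Matrix.mul_apply, Fin.sum_univ_three, SL2_mul_apply])

open MvPolynomial in
/-- The symmetric square of the standard representation in characteristic two. -/
def symSqRep (k : Type*) [Field k] (h2 : (2 : k) = 0) : SL2Rep k 3 :=
  SL2Rep.ofPolynomials
    !![X (0, 0) ^ 2, X (0, 0) * X (0, 1), X (0, 1) ^ 2; 0, 1, 0;
      X (1, 0) ^ 2, X (1, 0) * X (1, 1), X (1, 1) ^ 2]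
    (fun g => !![g 0 0 ^ 2, g 0 0 * g 0 1, g 0 1 ^ 2; 0, 1, 0;
      g 1 0 ^ 2, g 1 0 * g 1 1, g 1 1 ^ 2])
    (fun g i j => by fin_cases i <;> fin_cases j <;> simp)
    (fun g => by
      rw [Matrix.det_fin_three]
      simp
      -- For `g = (a b; c d)` the determinant is `(ad)² - (bc)²`, which is `(ad - bc)²` plus
      -- `2(ad·bc - (bc)²)`.
      linear_combination (g 0 0 * g 1 1 - g 0 1 * g 1 0 + 1) * SL2_det g
        + (g 0 0 * g 1 1 * g 0 1 * g 1 0 - (g 0 1 * g 1 0) ^ 2) * h2)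
    (by ext i j; fin_cases i <;> fin_cases j <;> simp)
    (fun g h => by
      -- The middle row of the symmetric square is `(2ac, ad + bc, 2bd)`; in characteristic two it
      -- becomes `(0, 1, 0)`, so the products agree only modulo `h2` and the determinant relation.
      have hh := SL2_det h
      ext i j
      fin_cases i <;> fin_cases j <;>
        simp [Matrix.mul_apply, Fin.sum_univ_three, SL2_mul_apply]
      · linear_combination (g 0 0 * h 0 0 * g 0 1 * h 1 0) * h2
      · linear_combination (g 0 0 * g 0 1) * hh + (g 0 0 * g 0 1 * h 0 1 * h 1 0) * h2
      · linear_combination (g 0 0 * h 0 1 * g 0 1 * h 1 1) * h2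
      · linear_combination (g 1 0 * h 0 0 * g 1 1 * h 1 0) * h2
      · linear_combination (g 1 0 * g 1 1) * hh + (g 1 0 * g 1 1 * h 0 1 * h 1 0) * h2
      · linear_combination (g 1 0 * h 0 1 * g 1 1 * h 1 1) * h2)

open MvPolynomial in
/-- The dual of the symmetric square of the standard representation in characteristic two. -/
def dualSymSqRep (k : Type*) [Field k] (h2 : (2 : k) = 0) : SL2Rep k 3 :=
  SL2Rep.ofPolynomials
    !![X (0, 0) ^ 2, 0, X (0, 1) ^ 2; X (0, 0) * X (1, 0), 1, X (0, 1) * X (1, 1);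
      X (1, 0) ^ 2, 0, X (1, 1) ^ 2]
    (fun g => !![g 0 0 ^ 2, 0, g 0 1 ^ 2; g 0 0 * g 1 0, 1, g 0 1 * g 1 1;
      g 1 0 ^ 2, 0, g 1 1 ^ 2])
    (fun g i j => by fin_cases i <;> fin_cases j <;> simp)
    (fun g => by
      rw [Matrix.det_fin_three]
      simp
      linear_combination (g 0 0 * g 1 1 - g 0 1 * g 1 0 + 1) * SL2_det g
        + (g 0 0 * g 1 1 * g 0 1 * g 1 0 - (g 0 1 * g 1 0) ^ 2) * h2)
    (by ext i j; fin_cases i <;> fin_cases j <;> simp)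
    (fun g h => by
      have hh := SL2_det g
      ext i j
      fin_cases i <;> fin_cases j <;>
        simp [Matrix.mul_apply, Fin.sum_univ_three, SL2_mul_apply]
      · linear_combination (g 0 0 * h 0 0 * g 0 1 * h 1 0) * h2
      · linear_combination (g 0 0 * h 0 1 * g 0 1 * h 1 1) * h2
      · linear_combination (h 0 0 * h 1 0) * hh + (h 0 0 * h 1 0 * g 0 1 * g 1 0) * h2
      · linear_combination (h 0 1 * h 1 1) * hh + (h 0 1 * h 1 1 * g 0 1 * g 1 0) * h2
      · linear_combination (g 1 0 * h 0 0 * g 1 1 * h 1 0) * h2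
      · linear_combination (g 1 0 * h 0 1 * g 1 1 * h 1 1) * h2)

open MvPolynomial in
/-- The symmetric square of the standard representation in characteristic different from two,
in the basis `x², xy, y²/2`. -/
def oddSymSqRep (k : Type*) [Field k] (h2 : (2 : k) ≠ 0) : SL2Rep k 3 :=
  SL2Rep.ofPolynomials
    !![X (0, 0) ^ 2, X (0, 0) * X (0, 1), C (1 / 2) * X (0, 1) ^ 2;
      C 2 * X (0, 0) * X (1, 0), X (0, 0) * X (1, 1) + X (0, 1) * X (1, 0), X (0, 1) * X (1, 1);
      C 2 * X (1, 0) ^ 2, C 2 * X (1, 0) * X (1, 1), X (1, 1) ^ 2]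
    (fun g => !![g 0 0 ^ 2, g 0 0 * g 0 1, (1 / 2) * g 0 1 ^ 2;
      2 * g 0 0 * g 1 0, g 0 0 * g 1 1 + g 0 1 * g 1 0, g 0 1 * g 1 1;
      2 * g 1 0 ^ 2, 2 * g 1 0 * g 1 1, g 1 1 ^ 2])
    (fun g i j => by
      fin_cases i <;> fin_cases j <;>
        simp)
    (fun g => by
      rw [Matrix.det_fin_three]
      simp
      have := SL2_det g
      -- The determinant of the symmetric square of `g` is `(det g)³`.
      have h3 : (g 0 0 * g 1 1 - g 0 1 * g 1 0) ^ 3 = 1 := by rw [this, one_pow]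
      refine Eq.trans ?_ h3
      field_simp
      ring)
    (by ext i j; fin_cases i <;> fin_cases j <;> simp)
    (fun g h => by
      ext i j
      fin_cases i <;> fin_cases j <;>
        simp [Matrix.mul_apply, Fin.sum_univ_three, SL2_mul_apply] <;>
        field_simp <;> ring)

variable (p : ℕ) [ExpChar k p] (e : ℕ)

theorem trivialRep_hasForm : HasForm (trivialRep k n).fundamental (fun _ => 1) := fun _ => rfl

theorem stdRep_hasForm : HasForm ((stdRep k).twist p e).fundamental
    (fun t => !![1, 0, t ^ p ^ e; 0, 1, 0; 0, 0, 1]) := by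
  intro t
  rw [SL2Rep.twist_fundamental_apply]
  rw [stdRep, SL2Rep.ofPolynomials_apply]
  simp [coe_iotaPlus]

theorem symSqRep_hasForm (h2 : (2 : k) = 0) : HasForm ((symSqRep k h2).twist p e).fundamental
    (fun t => !![1, t ^ p ^ e, t ^ (2 * p ^ e); 0, 1, 0; 0, 0, 1]) := by
  intro t
  rw [SL2Rep.twist_fundamental_apply]
  rw [symSqRep, SL2Rep.ofPolynomials_apply]
  simp [coe_iotaPlus, pow_mul']

theorem dualSymSqRep_hasForm (h2 : (2 : k) = 0) :
    HasForm ((dualSymSqRep k h2).twist p e).fundamental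
    (fun t => !![1, 0, t ^ (2 * p ^ e); 0, 1, t ^ p ^ e; 0, 0, 1]) := by
  intro t
  rw [SL2Rep.twist_fundamental_apply]
  rw [dualSymSqRep, SL2Rep.ofPolynomials_apply]
  simp [coe_iotaPlus, pow_mul']

theorem oddSymSqRep_hasForm (h2 : (2 : k) ≠ 0) :
    HasForm ((oddSymSqRep k h2).twist p e).fundamental
    (fun t => !![1, t ^ p ^ e, (1 / 2 : k) * t ^ (2 * p ^ e); 0, 1, t ^ p ^ e; 0, 0, 1]) := by
  intro t
  rw [SL2Rep.twist_fundamental_apply]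
  rw [oddSymSqRep, SL2Rep.ofPolynomials_apply]
  simp [coe_iotaPlus, pow_mul']

end Constructions

/-! ### Weights of the diagonal torus -/

section Weights

variable {k : Type*} [Field k]

/-- The restriction of a polynomial in the entries of a `2 × 2` matrix to the diagonal torus is a
Laurent polynomial. -/
theorem exists_laurent_torus (f : MvPolynomial (Fin 2 × Fin 2) k) :
    ∃ N : ℕ, ∀ m ≥ N, ∃ g : Polynomial k, ∀ a : kˣ,
      (a : k) ^ m * MvPolynomial.eval
        (fun ab => (!![(a : k), 0; 0, ((a⁻¹ : kˣ) : k)] : Matrix (Fin 2) (Fin 2) k) ab.1 ab.2) f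
        = g.eval (a : k) := by
  induction f using MvPolynomial.induction_on with
  | C c => exact ⟨0, fun m _ => ⟨Polynomial.C c * Polynomial.X ^ m, fun a => by
      simpa using mul_comm _ _⟩⟩
  | add f g hf hg =>
    obtain ⟨N, hN⟩ := hf
    obtain ⟨N', hN'⟩ := hg
    refine ⟨max N N', fun m hm => ?_⟩
    obtain ⟨F, hF⟩ := hN m (le_trans (le_max_left _ _) hm)
    obtain ⟨G, hG⟩ := hN' m (le_trans (le_max_right _ _) hm)
    exact ⟨F + G, fun a => by rw [map_add, mul_add, hF, hG, Polynomial.eval_add]⟩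
  | mul_X f i hf =>
    obtain ⟨N, hN⟩ := hf
    refine ⟨N + 1, fun m hm => ?_⟩
    obtain ⟨F, hF⟩ := hN (m - 1) (by omega)
    -- One power of `a` is held back: it cancels an entry `a⁻¹`, and joins an entry `a` to give `X ^
    -- 2`.
    obtain ⟨m, rfl⟩ : ∃ m', m = m' + 1 := ⟨m - 1, by omega⟩
    rw [Nat.add_sub_cancel] at hF
    obtain ⟨i, j⟩ := i
    fin_cases i <;> fin_cases j
    · refine ⟨F * Polynomial.X ^ 2, fun a => ?_⟩
      rw [Polynomial.eval_mul, ← hF]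
      simp
      ring
    · exact ⟨0, fun a => by simp⟩
    · exact ⟨0, fun a => by simp⟩
    · refine ⟨F, fun a => ?_⟩
      rw [← hF, map_mul, MvPolynomial.eval_X, pow_succ]
      generalize MvPolynomial.eval _ f = E
      simp
      field_simp

/-- If `a ^ n = 1` for all units with `n > 0`, then `X ^ (n + 1)` and `X` agree as functions on an
infinite field, hence as polynomials. -/
theorem zpow_units_injective [Infinite k] {l m : ℤ} (h : ∀ a : kˣ, a ^ l = a ^ m) : l = m := by
  by_contra hne
  have key : ∀ n : ℕ, 0 < n → ¬ ∀ a : kˣ, a ^ n = 1 := by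
    intro n hn hall
    have : (Polynomial.X ^ (n + 1) : Polynomial k) = Polynomial.X ^ 1 := by
      refine Polynomial.funext fun t => ?_
      rcases eq_or_ne t 0 with rfl | ht
      · simp
      · have := congrArg (Units.val) (hall (Units.mk0 t ht))
        simp only [Units.val_pow_eq_pow_val, Units.val_mk0, Units.val_one] at this
        simp [pow_succ, this]
    have := congrArg Polynomial.natDegree this
    simp only [Polynomial.natDegree_X_pow] at this
    omega
  have h1 : ∀ a : kˣ, a ^ (l - m) = 1 := fun a => by rw [_root_.zpow_sub, h, mul_inv_cancel]
  refine key (l - m).natAbs (by omega) fun a => ?_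
  rcases Int.natAbs_eq (l - m) with h' | h'
  · rw [← zpow_natCast, ← h', h1]
  · rw [← zpow_natCast, ← _root_.inv_inj, ← _root_.zpow_neg, ← h', h1, inv_one]

theorem eq_of_eval_units_eq [Infinite k] {f g : Polynomial k}
    (h : ∀ a : kˣ, f.eval (a : k) = g.eval (a : k)) : f = g := by
  have : Polynomial.X * f = Polynomial.X * g := by
    refine Polynomial.funext fun t => ?_
    rcases eq_or_ne t 0 with rfl | ht
    · simp
    · have := h (Units.mk0 t ht)
      simp only [Units.val_mk0] at this
      simp [this]
  exact mul_left_cancel₀ Polynomial.X_ne_zero this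

/-- A homomorphism from the multiplicative group to matrices given by Laurent polynomials is
diagonalizable, with integral weights. -/
theorem exists_weight_basis [Infinite k] {n : ℕ} (h : kˣ →* Matrix (Fin n) (Fin n) k)
    (hreg : ∀ i j, ∃ N : ℕ, ∀ m ≥ N, ∃ g : Polynomial k, ∀ a : kˣ,
      (a : k) ^ m * h a i j = g.eval (a : k)) :
    ∃ (Q : GL (Fin n) k) (l : Fin n → ℤ), ∀ a : kˣ,
      h a * (Q : Matrix (Fin n) (Fin n) k)
        = (Q : Matrix (Fin n) (Fin n) k) * diagonal fun i => ((a ^ l i : kˣ) : k) := by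
  choose N₀ hN₀ using hreg
  set N := Finset.univ.sup fun ij : Fin n × Fin n => N₀ ij.1 ij.2
  have hN : ∀ i j, N₀ i j ≤ N := fun i j =>
    Finset.le_sup (f := fun ij : Fin n × Fin n => N₀ ij.1 ij.2) (Finset.mem_univ (i, j))
  choose g hg using fun i j => hN₀ i j N (hN i j)
  -- These are the coefficient matrices of `a ^ N • h a`. Comparing coefficients in `h b * h a = h
  -- (b * a)` shows that the columns of `M d` are weight vectors of weight `d - N`.
  let M : ℕ → Matrix (Fin n) (Fin n) k := fun d => Matrix.of fun i j => (g i j).coeff d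
  have hM : ∀ d (b : kˣ), h b * M d = ((b ^ ((d : ℤ) - N) : kˣ) : k) • M d := by
    intro d b
    ext r c
    have hpoly : ∑ s, Polynomial.C (h b r s) * g s c
        = Polynomial.C ((b ^ (-(N : ℤ)) : kˣ) : k)
          * (g r c).comp (Polynomial.C (b : k) * Polynomial.X) := by
      refine eq_of_eval_units_eq fun a => ?_
      have h1 := hg r c (b * a)
      simp only [Polynomial.eval_finsetSum, Polynomial.eval_mul, Polynomial.eval_C,
        Polynomial.eval_comp, Polynomial.eval_X, ← hg]
      rw [Units.val_mul] at h1
      rw [← h1, map_mul, Matrix.mul_apply, mul_pow, Finset.mul_sum, Finset.mul_sum]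
      refine Finset.sum_congr rfl fun s _ => ?_
      rw [_root_.zpow_neg, zpow_natCast]
      simp only [Units.val_inv_eq_inv_val, Units.val_pow_eq_pow_val]
      field_simp
    have hc := congrArg (fun f => Polynomial.coeff f d) hpoly
    simp only [Polynomial.finsetSum_coeff, Polynomial.coeff_C_mul,
      Polynomial.comp_C_mul_X_coeff] at hc
    rw [Matrix.mul_apply, Matrix.smul_apply]
    simp only [M, Matrix.of_apply, smul_eq_mul]
    rw [hc, sub_eq_neg_add, _root_.zpow_add, zpow_natCast]
    push_cast
    ring
  let S : Set (Fin n → k) := {v | ∃ l : ℤ, ∀ a : kˣ, h a *ᵥ v = ((a ^ l : kˣ) : k) • v}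
  have hcol : ∀ d c, (M d).col c ∈ S := fun d c => ⟨(d : ℤ) - N, fun a => by
    have := congrArg (fun A => A.col c) (hM d a)
    ext r
    have := congrFun this r
    simpa [Matrix.col, Matrix.mul_apply, Matrix.mulVec, dotProduct] using this⟩
  have hS : ⊤ ≤ Submodule.span k S := by
    rw [← (Pi.basisFun k (Fin n)).span_eq, Submodule.span_le]
    rintro _ ⟨c, rfl⟩
    set D := (Finset.univ.sup fun r => (g r c).natDegree) + 1
    -- Evaluation at `a = 1` shows that the matrices `M d` sum to the identity, so weight vectors
    -- span.
    have : Pi.basisFun k (Fin n) c = ∑ d ∈ Finset.range D, (M d).col c := by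
      ext r
      have hD : (g r c).natDegree < D :=
        Nat.lt_succ_of_le (Finset.le_sup (f := fun r => (g r c).natDegree) (Finset.mem_univ r))
      have h1 := hg r c 1
      rw [Polynomial.eval_eq_sum_range' hD] at h1
      simp only [Units.val_one, one_pow, mul_one, one_mul, map_one] at h1
      rw [Finset.sum_apply]
      simp only [M, Matrix.col, Matrix.transpose_apply, Matrix.of_apply]
      rw [← h1, Pi.basisFun_apply, Matrix.one_apply, Pi.single_apply]
    rw [this]
    exact Submodule.sum_mem _ fun d _ => Submodule.subset_span (hcol d c)
  let b₀ := Module.Basis.ofSpan hS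
  let b := b₀.reindex (b₀.indexEquiv (Pi.basisFun k (Fin n)))
  have hb : ∀ i, b i ∈ S := fun i => by
    rw [Module.Basis.reindex_apply]
    exact Module.Basis.ofSpan_subset hS (Set.mem_range_self _)
  choose l hl using hb
  let Q : Matrix (Fin n) (Fin n) k := (Pi.basisFun k (Fin n)).toMatrix b
  have hQ : IsUnit Q := by
    have := (Pi.basisFun k (Fin n)).invertibleToMatrix b
    exact isUnit_of_invertible Q
  refine ⟨hQ.unit, l, fun a => ?_⟩
  ext r c
  have := congrFun (hl c a) r
  rw [IsUnit.unit_spec, Matrix.mul_diagonal, Matrix.mul_apply]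
  simpa [Matrix.mulVec, dotProduct, Q, Module.Basis.toMatrix_apply, mul_comm] using this

/-- The diagonal torus of `SL(2, k)`. -/
def torus (k : Type*) [Field k] : kˣ →* SpecialLinearGroup (Fin 2) k where
  toFun a := ⟨!![(a : k), 0; 0, ((a⁻¹ : kˣ) : k)], by simp [Matrix.det_fin_two_of]⟩
  map_one' := by
    ext i j
    fin_cases i <;> fin_cases j <;> simp
  map_mul' a b := by
    refine Subtype.ext ?_
    change _ = !![(a : k), 0; 0, ((a⁻¹ : kˣ) : k)] * !![(b : k), 0; 0, ((b⁻¹ : kˣ) : k)]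
    simp [mul_comm]

theorem coe_torus (a : kˣ) : (torus k a : Matrix (Fin 2) (Fin 2) k)
    = !![(a : k), 0; 0, ((a⁻¹ : kˣ) : k)] := rfl

/-- The nontrivial Weyl element of `SL(2, k)`. -/
def weyl (k : Type*) [Field k] : SpecialLinearGroup (Fin 2) k :=
  ⟨!![0, 1; -1, 0], by simp [Matrix.det_fin_two_of]⟩

theorem torus_mul_weyl (a : kˣ) : torus k a * weyl k = weyl k * torus k a⁻¹ := by
  refine Subtype.ext ?_
  change !![(a : k), 0; 0, ((a⁻¹ : kˣ) : k)] * !![0, 1; -1, 0]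
    = !![0, 1; -1, 0] * !![((a⁻¹ : kˣ) : k), 0; 0, (((a⁻¹)⁻¹ : kˣ) : k)]
  simp

/-- This relation is what makes the entries of `u` homogeneous in a weight basis. -/
theorem torus_mul_iotaPlus (a : kˣ) (t : k) :
    torus k a * iotaPlus t = iotaPlus ((a : k) ^ 2 * t) * torus k a := by
  refine Subtype.ext ?_
  change !![(a : k), 0; 0, ((a⁻¹ : kˣ) : k)] * !![1, t; 0, 1]
    = !![1, (a : k) ^ 2 * t; 0, 1] * !![(a : k), 0; 0, ((a⁻¹ : kˣ) : k)]
  have : (a : k) ≠ 0 := a.ne_zero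
  simp
  field_simp

/-- A nonzero weight comes with its negative, and the zero sum makes the third weight vanish. -/
theorem exists_perm_of_weights {l : Fin 3 → ℤ} (hsum : ∑ i, l i = 0)
    (hsymm : ∀ j, ∃ i, l i = -l j) :
    ∃ (σ : Equiv.Perm (Fin 3)) (m : ℕ), ∀ i, l (σ i) = ![(m : ℤ), 0, -m] i := by
  rw [Fin.sum_univ_three] at hsum
  by_cases h0 : ∀ i, l i = 0
  · exact ⟨1, 0, fun i => by fin_cases i <;> simp [h0]⟩
  · push Not at h0
    obtain ⟨i, j, hpos, hij⟩ : ∃ i j, 0 < l i ∧ l j = -l i := by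
      obtain ⟨i, hi⟩ := h0
      obtain ⟨j, hj⟩ := hsymm i
      rcases lt_or_gt_of_ne hi with h | h
      · exact ⟨j, i, by omega, by omega⟩
      · exact ⟨i, j, h, hj⟩
    have hne : i ≠ j := by rintro rfl; omega
    have hperm : ∀ i j : Fin 3, i ≠ j → ∃ s : Equiv.Perm (Fin 3), s 0 = i ∧ s 2 = j := by decide
    obtain ⟨s, hs0, hs2⟩ := hperm i j hne
    refine ⟨s, (l i).toNat, fun r => ?_⟩
    have hs : ∑ r, l (s r) = ∑ r, l r := Equiv.sum_comp s l
    rw [Fin.sum_univ_three, Fin.sum_univ_three, hs0, hs2] at hs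
    fin_cases r <;> simp [hs0, hs2] <;> omega

end Weights

/-! ### Reduction to unitriangular matrices with monomial entries -/

section NormalForm

variable {k : Type*} [Field k]

/-- The hypothesis is a polynomial identity `X ^ d * f(X²) = c`; its value at `0` gives `c = 0`.
This kills entries of negative weight difference. -/
theorem eq_zero_of_expand_neg [Infinite k] {f : Polynomial k} {c : k} {d : ℕ} (hd : 0 < d)
    (h : ∀ a : kˣ, (a : k) ^ d * f.eval ((a : k) ^ 2) = c) : f = 0 := by
  have key : Polynomial.X ^ d * Polynomial.expand k 2 f = Polynomial.C c :=
    eq_of_eval_units_eq fun a => by simp [h a]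
  have hc : c = 0 := by
    have := congrArg (Polynomial.eval 0) key
    simpa [hd.ne'] using this.symm
  rw [hc, map_zero, mul_eq_zero] at key
  rcases key with h | h
  · simp at h
  · rwa [Polynomial.expand_eq_zero two_pos] at h

/-- Since `f(X²) = c X ^ d` has only even exponents on the left, an odd `d` forces `c = 0`. -/
theorem monomial_of_expand [Infinite k] {f : Polynomial k} {c : k} {d : ℕ}
    (h : ∀ a : kˣ, f.eval ((a : k) ^ 2) = (a : k) ^ d * c) :
    f = 0 ∨ ∃ n, d = 2 * n ∧ f = Polynomial.C c * Polynomial.X ^ n := by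
  have key : Polynomial.expand k 2 f = Polynomial.C c * Polynomial.X ^ d :=
    eq_of_eval_units_eq fun a => by
      simpa [h a] using mul_comm _ _
  rcases Nat.even_or_odd' d with ⟨n, rfl | rfl⟩
  · refine Or.inr ⟨n, rfl, Polynomial.expand_injective two_pos ?_⟩
    rw [key]
    simp [pow_mul]
  · left
    have hc := congrArg (fun g => Polynomial.coeff g (2 * n + 1)) key
    rw [Polynomial.coeff_expand two_pos, if_neg (by omega), Polynomial.coeff_C_mul,
      Polynomial.coeff_X_pow_self, mul_one] at hc
    rw [← hc, map_zero, zero_mul, Polynomial.expand_eq_zero two_pos] at key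
    exact key

/-- The unipotent matrices to which every fundamental representation is conjugate. -/
def unip (α β γ : k) (n m : ℕ) (t : k) : Matrix (Fin 3) (Fin 3) k :=
  !![1, α * t ^ n, β * t ^ m; 0, 1, γ * t ^ n; 0, 0, 1]

/-- Simultaneous conjugacy of families of matrices. -/
def Conj {n : ℕ} (M N : k → Matrix (Fin n) (Fin n) k) : Prop :=
  ∃ P : GL (Fin n) k, ∀ t, M t * (P : Matrix (Fin n) (Fin n) k) = P * N t

theorem Conj.of_det {n : ℕ} {M N : k → Matrix (Fin n) (Fin n) k} (P : Matrix (Fin n) (Fin n) k)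
    (hP : P.det ≠ 0) (h : ∀ t, M t * P = P * N t) : Conj M N :=
  ⟨GeneralLinearGroup.mkOfDetNeZero P hP, h⟩

theorem Conj.trans {n : ℕ} {M N R : k → Matrix (Fin n) (Fin n) k} (h : Conj M N) (h' : Conj N R) :
    Conj M R := by
  obtain ⟨P, hP⟩ := h
  obtain ⟨Q, hQ⟩ := h'
  refine ⟨P * Q, fun t => ?_⟩
  rw [Units.val_mul, ← Matrix.mul_assoc, hP, Matrix.mul_assoc, hQ, Matrix.mul_assoc]

theorem equivalent_iff_conj {n : ℕ} {u v : GaRep k n} :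
    u.Equivalent v ↔ Conj (fun t => (u.toFun t : Matrix (Fin n) (Fin n) k))
      (fun t => (v.toFun t : Matrix (Fin n) (Fin n) k)) := by
  refine exists_congr fun P => forall_congr' fun t => ?_
  beta_reduce
  rw [Matrix.mul_assoc]
  constructor
  · intro h
    rw [← h, Units.mul_inv_cancel_left]
  · intro h
    rw [h, Units.inv_mul_cancel_left]

theorem GaRep.toFun_zero {n : ℕ} (u : GaRep k n) : u.toFun 0 = 1 := by
  have := u.map_add 0 0
  rw [add_zero] at this
  exact left_eq_mul.mp this

/-- The weights of a three-dimensional representation of `SL(2, k)` are `m, 0, -m`. -/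
theorem exists_torus_basis [Infinite k] (ψ : SL2Rep k 3) :
    ∃ (Q : GL (Fin 3) k) (m : ℕ), ∀ a : kˣ,
      (ψ.toHom (torus k a) : Matrix (Fin 3) (Fin 3) k) * (Q : Matrix (Fin 3) (Fin 3) k)
        = Q * diagonal fun i => ((a ^ (![(m : ℤ), 0, -m] i) : kˣ) : k) := by
  let h : kˣ →* Matrix (Fin 3) (Fin 3) k :=
    { toFun := fun a => (ψ.toHom (torus k a) : Matrix (Fin 3) (Fin 3) k)
      map_one' := by rw [map_one, map_one]; rfl
      map_mul' := fun a b => by rw [map_mul, map_mul]; rfl }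
  have hh : ∀ a, h a = (ψ.toHom (torus k a) : Matrix (Fin 3) (Fin 3) k) := fun _ => rfl
  obtain ⟨Q, l, hQ⟩ := exists_weight_basis h (fun i j => by
    obtain ⟨f, hf⟩ := ψ.regular i j
    obtain ⟨N, hN⟩ := exists_laurent_torus f
    refine ⟨N, fun m hm => ?_⟩
    obtain ⟨g, hg⟩ := hN m hm
    refine ⟨g, fun a => ?_⟩
    rw [← hg, hh, hf, coe_torus])
  have hdet : (Q : Matrix (Fin 3) (Fin 3) k).det ≠ 0 :=
    ((Matrix.isUnit_iff_isUnit_det _).mp Q.isUnit).ne_zero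
  have hsum : ∑ i, l i = 0 := by
    refine zpow_units_injective (k := k) fun a => ?_
    have := congrArg Matrix.det (hQ a)
    rw [det_mul, det_mul, det_diagonal, hh, (ψ.toHom (torus k a)).2, one_mul] at this
    have h1 : ∏ i, ((a ^ l i : kˣ) : k) = 1 := by
      field_simp at this
      exact this.symm
    rw [zpow_zero, ← Units.val_inj, Units.val_one, ← h1, Fin.sum_univ_three, Fin.prod_univ_three,
      _root_.zpow_add, _root_.zpow_add]
    simp
  have hsymm : ∀ j, ∃ i, l i = -l j := by
    intro j
    let W : Matrix (Fin 3) (Fin 3) k := ψ.toHom (weyl k)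
    let X : Matrix (Fin 3) (Fin 3) k := (Q⁻¹ : GL (Fin 3) k) * (W * Q)
    have hQX : (Q : Matrix (Fin 3) (Fin 3) k) * X = W * Q := by
      simp only [X, Units.mul_inv_cancel_left]
    have hXdet : X.det ≠ 0 := by
      intro h0
      have := congrArg Matrix.det hQX
      rw [det_mul, h0, mul_zero, det_mul, (ψ.toHom (weyl k)).2, one_mul] at this
      exact hdet this.symm
    have hcomm : ∀ a : kˣ, (diagonal fun i => ((a ^ l i : kˣ) : k)) * X
        = X * diagonal fun i => ((a⁻¹ ^ l i : kˣ) : k) := by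
      intro a
      have hw : h a * W = W * h a⁻¹ := by
        have := congrArg (fun g => (ψ.toHom g : Matrix (Fin 3) (Fin 3) k)) (torus_mul_weyl a)
        simp only [map_mul, Matrix.SpecialLinearGroup.coe_mul] at this
        exact this
      refine Q.isUnit.mul_left_cancel ?_
      rw [← Matrix.mul_assoc, ← hQ, Matrix.mul_assoc, hQX, ← Matrix.mul_assoc, hw,
        Matrix.mul_assoc, hQ, ← Matrix.mul_assoc, ← hQX, Matrix.mul_assoc]
    -- `X` is the Weyl element in the weight basis. It intertwines `a` and `a⁻¹`, so any nonzero
    -- entry `X i j` forces `l i = -l j`, and column `j` of an invertible matrix has one.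
    obtain ⟨i, hi⟩ : ∃ i, X i j ≠ 0 := by
      by_contra! hall
      exact hXdet (det_eq_zero_of_column_eq_zero j hall)
    refine ⟨i, zpow_units_injective (k := k) fun a => ?_⟩
    have := congrFun (congrFun (hcomm a) i) j
    rw [diagonal_mul, mul_diagonal, mul_comm] at this
    have := mul_left_cancel₀ hi this
    rw [Units.val_inj] at this
    rw [this, _root_.inv_zpow, _root_.zpow_neg]
  obtain ⟨σ, m, hσ⟩ := exists_perm_of_weights hsum hsymm
  refine ⟨GeneralLinearGroup.mkOfDetNeZero ((Q : Matrix (Fin 3) (Fin 3) k).submatrix id σ) ?_, m,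
    fun a => ?_⟩
  · rw [det_permute']
    rcases Int.units_eq_one_or (Equiv.Perm.sign σ) with h | h <;> simp [h, hdet]
  · ext i j
    have := congrFun (congrFun (hQ a) i) (σ j)
    rw [mul_diagonal, mul_apply] at this
    change ((ψ.toHom (torus k a) : Matrix (Fin 3) (Fin 3) k)
      * ((Q : Matrix (Fin 3) (Fin 3) k).submatrix id σ)) i j
      = (((Q : Matrix (Fin 3) (Fin 3) k).submatrix id σ)
        * diagonal fun i => ((a ^ (![(m : ℤ), 0, -m] i) : kˣ) : k)) i j
    rw [mul_diagonal, mul_apply, ← hσ]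
    exact this

/-- With weights `m, 0, -m`, the corner entry has degree `m` and the two entries beside the diagonal
have degree `m / 2`. For odd `m` the latter vanish and `n` carries no information, hence the
conditional `m = 2 * n`. -/
theorem conj_unip [Infinite k] {u : GaRep k 3} (hu : u.IsFundamental) :
    ∃ (α β γ : k) (n m : ℕ), (α ≠ 0 ∨ γ ≠ 0 → m = 2 * n) ∧
      Conj (fun t => (u.toFun t : Matrix (Fin 3) (Fin 3) k)) (unip α β γ n m) := by
  obtain ⟨ψ, hψ⟩ := hu
  obtain ⟨Q, m, hQ⟩ := exists_torus_basis ψ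
  let U : k → Matrix (Fin 3) (Fin 3) k := fun t =>
    (Q⁻¹ : GL (Fin 3) k) * ((u.toFun t : Matrix (Fin 3) (Fin 3) k) * Q)
  have hQU : ∀ t, (u.toFun t : Matrix (Fin 3) (Fin 3) k) * Q = Q * U t := fun t => by
    simp only [U, Units.mul_inv_cancel_left]
  have hU0 : U 0 = 1 := by
    have h0 : ((u.toFun 0 : SpecialLinearGroup (Fin 3) k) : Matrix (Fin 3) (Fin 3) k) = 1 := by
      rw [u.toFun_zero]; rfl
    simp only [U, h0, Matrix.one_mul, Units.inv_mul]
  have hscale : ∀ (a : kˣ) (t : k) (i j : Fin 3),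
      ((a ^ (![(m : ℤ), 0, -m] i) : kˣ) : k) * U t i j
        = U ((a : k) ^ 2 * t) i j * ((a ^ (![(m : ℤ), 0, -m] j) : kˣ) : k) := by
    intro a t i j
    suffices hmat : (diagonal fun i => ((a ^ (![(m : ℤ), 0, -m] i) : kˣ) : k)) * U t
        = U ((a : k) ^ 2 * t) * diagonal fun i => ((a ^ (![(m : ℤ), 0, -m] i) : kˣ) : k) by
      have := congrFun (congrFun hmat i) j
      rwa [diagonal_mul, mul_diagonal] at this
    refine Q.isUnit.mul_left_cancel ?_
    have h1 := congrArg (fun g => (ψ.toHom g : Matrix (Fin 3) (Fin 3) k)) (torus_mul_iotaPlus a t)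
    simp only [map_mul, Matrix.SpecialLinearGroup.coe_mul, hψ] at h1
    rw [← Matrix.mul_assoc, ← hQ, Matrix.mul_assoc, ← hQU, ← Matrix.mul_assoc, h1,
      Matrix.mul_assoc, hQ, ← Matrix.mul_assoc, hQU, Matrix.mul_assoc]
  have hpoly : ∀ i j, ∃ f : Polynomial k, ∀ t, U t i j = f.eval t := by
    choose f hf using u.regular
    intro i j
    refine ⟨∑ r, Polynomial.C (((Q⁻¹ : GL (Fin 3) k) : Matrix (Fin 3) (Fin 3) k) i r)
      * ∑ s, f r s * Polynomial.C ((Q : Matrix (Fin 3) (Fin 3) k) s j), fun t => ?_⟩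
    simp only [U, Matrix.mul_apply, Polynomial.eval_finsetSum, Polynomial.eval_mul,
      Polynomial.eval_C, hf]
  choose f hf using hpoly
  have hf1 : ∀ (i j : Fin 3) (a : kˣ), ((a ^ (![(m : ℤ), 0, -m] i) : kˣ) : k) * (f i j).eval 1
      = (f i j).eval ((a : k) ^ 2) * ((a ^ (![(m : ℤ), 0, -m] j) : kˣ) : k) := fun i j a => by
    rw [← hf, ← hf, hscale, mul_one]
  have up : ∀ (i j : Fin 3) (d : ℕ), ![(m : ℤ), 0, -m] i = d + ![(m : ℤ), 0, -m] j →
      f i j = 0 ∨ ∃ n, d = 2 * n ∧ f i j = Polynomial.C ((f i j).eval 1) * Polynomial.X ^ n := by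
    intro i j d hd
    refine monomial_of_expand fun a => ?_
    have := hf1 i j a
    rw [hd, _root_.zpow_add, zpow_natCast, Units.val_mul, Units.val_pow_eq_pow_val] at this
    refine mul_right_cancel₀ (Units.ne_zero (a ^ (![(m : ℤ), 0, -m] j))) ?_
    rw [← this]
    ring
  have low : ∀ (i j : Fin 3) (d : ℕ), 0 < d → ![(m : ℤ), 0, -m] j = d + ![(m : ℤ), 0, -m] i →
      f i j = 0 := by
    intro i j d hpos hd
    refine eq_zero_of_expand_neg (c := (f i j).eval 1) hpos fun a => ?_
    have := hf1 i j a
    rw [hd, _root_.zpow_add, zpow_natCast, Units.val_mul, Units.val_pow_eq_pow_val] at this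
    refine mul_left_cancel₀ (Units.ne_zero (a ^ (![(m : ℤ), 0, -m] i))) ?_
    rw [this]
    ring
  have const : ∀ i j : Fin 3, ![(m : ℤ), 0, -m] i = ![(m : ℤ), 0, -m] j →
      ∀ t, U t i j = (1 : Matrix (Fin 3) (Fin 3) k) i j := by
    intro i j hij t
    rw [← hU0, hf, hf]
    rcases up i j 0 (by simpa using hij) with h | ⟨n, hn, h⟩
    · rw [h]; simp
    · obtain rfl : n = 0 := by omega
      rw [h]; simp
  have main : ∃ (α β γ : k) (n m : ℕ), (α ≠ 0 ∨ γ ≠ 0 → m = 2 * n) ∧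
      ∀ t, U t = unip α β γ n m t := by
    -- For `m = 0` all weights agree, every entry is constant, and `U` is the identity.
    rcases Nat.eq_zero_or_pos m with rfl | hm
    · refine ⟨0, 0, 0, 0, 0, by simp, fun t => ?_⟩
      ext i j
      rw [const i j (by fin_cases i <;> fin_cases j <;> simp)]
      fin_cases i <;> fin_cases j <;> simp [unip]
    · have e00 := const 0 0 rfl
      have e11 := const 1 1 rfl
      have e22 := const 2 2 rfl
      have l10 := low 1 0 m hm (by simp)
      have l21 := low 2 1 m hm (by simp)
      have l20 := low 2 0 (2 * m) (by omega) (by simp; omega)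
      have e02 : ∃ β, f 0 2 = Polynomial.C β * Polynomial.X ^ m := by
        rcases up 0 2 (2 * m) (by simp; omega) with h | ⟨n, hn, h⟩
        · exact ⟨0, by rw [h]; simp⟩
        · obtain rfl : n = m := by omega
          exact ⟨_, h⟩
      obtain ⟨β, hβ⟩ := e02
      obtain ⟨n, α, γ, h2, h01, h12⟩ : ∃ (n : ℕ) (α γ : k), (α ≠ 0 ∨ γ ≠ 0 → m = 2 * n) ∧
          f 0 1 = Polynomial.C α * Polynomial.X ^ n ∧ f 1 2 = Polynomial.C γ * Polynomial.X ^ n := by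
        rcases Nat.even_or_odd' m with ⟨n, hn | hn⟩
        · have aux : ∀ i j : Fin 3, ![(m : ℤ), 0, -m] i = m + ![(m : ℤ), 0, -m] j →
              ∃ α, f i j = Polynomial.C α * Polynomial.X ^ n := by
            intro i j hij
            rcases up i j m hij with h | ⟨n', hn', h⟩
            · exact ⟨0, by rw [h]; simp⟩
            · obtain rfl : n' = n := by omega
              exact ⟨_, h⟩
          obtain ⟨α, hα⟩ := aux 0 1 (by simp)
          obtain ⟨γ, hγ⟩ := aux 1 2 (by simp)
          exact ⟨n, α, γ, fun _ => hn, hα, hγ⟩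
        · have aux : ∀ i j : Fin 3, ![(m : ℤ), 0, -m] i = m + ![(m : ℤ), 0, -m] j →
              f i j = 0 := by
            intro i j hij
            rcases up i j m hij with h | ⟨n', hn', h⟩
            · exact h
            · omega
          exact ⟨0, 0, 0, by simp, by simp [aux 0 1 (by simp)], by simp [aux 1 2 (by simp)]⟩
      refine ⟨α, β, γ, n, m, h2, fun t => ?_⟩
      ext i j
      fin_cases i <;> fin_cases j <;>
        simp [unip, e00, e11, e22, hf, l10, l20, l21, hβ, h01, h12]
  obtain ⟨α, β, γ, n, m, h2, hU⟩ := main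
  exact ⟨α, β, γ, n, m, h2, Q, fun t => by rw [← hU, hQU]⟩

theorem conj_map_add {u : GaRep k 3} {M : k → Matrix (Fin 3) (Fin 3) k}
    (h : Conj (fun t => (u.toFun t : Matrix (Fin 3) (Fin 3) k)) M) (s t : k) :
    M (s + t) = M s * M t := by
  obtain ⟨P, hP⟩ := h
  beta_reduce at hP
  refine P.isUnit.mul_left_cancel ?_
  rw [← hP, u.map_add, Matrix.SpecialLinearGroup.coe_mul, Matrix.mul_assoc, hP,
    ← Matrix.mul_assoc, hP, Matrix.mul_assoc]

/-- Write `n = p ^ e * r` with `p ∤ r`. Frobenius is surjective, so `r`-th powers are additive too.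
If `r ≠ 1`, the coefficient of `X` in `(X + 1) ^ r = X ^ r + 1` gives `r = 0` in `k`, a
contradiction. -/
theorem eq_prime_pow_of_additive [IsAlgClosed k] (p : ℕ) [Fact p.Prime] [CharP k p] {n : ℕ}
    (h : ∀ s t : k, (s + t) ^ n = s ^ n + t ^ n) : ∃ e, n = p ^ e := by
  have hn : n ≠ 0 := by
    rintro rfl
    simpa using h 0 0
  obtain ⟨e, r, hr, rfl⟩ := Nat.exists_eq_pow_mul_and_not_dvd hn p (Fact.out : p.Prime).ne_one
  have hr' : ∀ s t : k, (s + t) ^ r = s ^ r + t ^ r := by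
    intro s t
    have hsurj : Function.Surjective fun x : k => x ^ p ^ e := fun y =>
      IsAlgClosed.exists_pow_nat_eq y (pow_pos (Fact.out : p.Prime).pos e)
    obtain ⟨x, rfl⟩ := hsurj s
    obtain ⟨y, rfl⟩ := hsurj t
    simp only
    rw [← add_pow_char_pow, ← pow_mul, ← pow_mul, ← pow_mul, h]
  refine ⟨e, ?_⟩
  have : r = 1 := by
    by_contra hne
    have hr0 : r ≠ 0 := by rintro rfl; exact hr (dvd_zero p)
    have hpoly : ((Polynomial.X + 1) ^ r : Polynomial k) = Polynomial.X ^ r + 1 :=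
      Polynomial.funext fun t => by simp [hr']
    have := congrArg (fun g => Polynomial.coeff g 1) hpoly
    rw [Polynomial.coeff_X_add_one_pow, Polynomial.coeff_add, Polynomial.coeff_X_pow,
      if_neg (Ne.symm hne), Polynomial.coeff_one, if_neg one_ne_zero, Nat.choose_one_right,
      add_zero, CharP.cast_eq_zero_iff k p] at this
    exact hr this
  rw [this, mul_one]

end NormalForm

/-! ### The list of normal forms -/

section Classification

variable {k : Type*} [Field k]

/-- `t ↦ I + t^q E₁₃`. -/
def stdForm (k : Type*) [Field k] (q : ℕ) (t : k) : Matrix (Fin 3) (Fin 3) k :=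
  !![1, 0, t ^ q; 0, 1, 0; 0, 0, 1]

/-- `t ↦ I + t^q E₁₂ + t^(2q) E₁₃`. -/
def symSqForm (k : Type*) [Field k] (q : ℕ) (t : k) : Matrix (Fin 3) (Fin 3) k :=
  !![1, t ^ q, t ^ (2 * q); 0, 1, 0; 0, 0, 1]

/-- `t ↦ I + t^(2q) E₁₃ + t^q E₂₃`. -/
def dualSymSqForm (k : Type*) [Field k] (q : ℕ) (t : k) : Matrix (Fin 3) (Fin 3) k :=
  !![1, 0, t ^ (2 * q); 0, 1, t ^ q; 0, 0, 1]

/-- `t ↦ exp (t^q (E₁₂ + E₂₃))`. -/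
def oddSymSqForm (k : Type*) [Field k] (q : ℕ) (t : k) : Matrix (Fin 3) (Fin 3) k :=
  !![1, t ^ q, (1 / 2 : k) * t ^ (2 * q); 0, 1, t ^ q; 0, 0, 1]

theorem conj_unip_stdForm {β : k} (hβ : β ≠ 0) (n m : ℕ) :
    Conj (unip 0 β 0 n m) (stdForm k m) := by
  refine Conj.of_det !![β, 0, 0; 0, 1, 0; 0, 0, 1] (by simp [det_fin_three, hβ]) fun t => ?_
  ext i j
  fin_cases i <;> fin_cases j <;> simp [unip, stdForm, mul_apply, Fin.sum_univ_three]

/-- Exchanging the last two basis vectors carries `E₁₂` to `E₁₃`. -/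
theorem conj_unip_stdForm_left {α : k} (hα : α ≠ 0) (n m : ℕ) :
    Conj (unip α 0 0 n m) (stdForm k n) := by
  refine Conj.of_det !![α, 0, 0; 0, 0, 1; 0, 1, 0] (by simp [det_fin_three, hα]) fun t => ?_
  ext i j
  fin_cases i <;> fin_cases j <;> simp [unip, stdForm, mul_apply, Fin.sum_univ_three]

/-- Exchanging the first two basis vectors carries `E₂₃` to `E₁₃`. -/
theorem conj_unip_stdForm_right {γ : k} (hγ : γ ≠ 0) (n m : ℕ) :
    Conj (unip 0 0 γ n m) (stdForm k n) := by
  refine Conj.of_det !![0, 1, 0; γ, 0, 0; 0, 0, 1] (by simp [det_fin_three, hγ]) fun t => ?_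
  ext i j
  fin_cases i <;> fin_cases j <;> simp [unip, stdForm, mul_apply, Fin.sum_univ_three]

theorem conj_unip_symSqForm {α β : k} (hα : α ≠ 0) (hβ : β ≠ 0) (n : ℕ) :
    Conj (unip α β 0 n (2 * n)) (symSqForm k n) := by
  refine Conj.of_det !![α * β, 0, 0; 0, β, 0; 0, 0, α] (by simp [det_fin_three, hα, hβ])
    fun t => ?_
  ext i j
  fin_cases i <;> fin_cases j <;> simp [unip, symSqForm, mul_apply, Fin.sum_univ_three] <;> ring

theorem conj_unip_dualSymSqForm {β γ : k} (hγ : γ ≠ 0) (hβ : β ≠ 0) (n : ℕ) :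
    Conj (unip 0 β γ n (2 * n)) (dualSymSqForm k n) := by
  refine Conj.of_det !![β, 0, 0; 0, γ, 0; 0, 0, 1] (by simp [det_fin_three, hγ, hβ])
    fun t => ?_
  ext i j
  fin_cases i <;> fin_cases j <;> simp [unip, dualSymSqForm, mul_apply, Fin.sum_univ_three]

theorem conj_unip_oddSymSqForm (h2 : (2 : k) ≠ 0) {α β γ : k} (hα : α ≠ 0) (hγ : γ ≠ 0)
    (hβ : 2 * β = α * γ) (n : ℕ) : Conj (unip α β γ n (2 * n)) (oddSymSqForm k n) := by
  obtain rfl : β = 1 / 2 * (α * γ) := by rw [← hβ]; field_simp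
  refine Conj.of_det !![α * γ, 0, 0; 0, γ, 0; 0, 0, 1] (by simp [det_fin_three, hα, hγ])
    fun t => ?_
  ext i j
  fin_cases i <;> fin_cases j <;>
    simp [unip, oddSymSqForm, mul_apply, Fin.sum_univ_three] <;> ring

/-- The list of all fundamental representations up to conjugacy. -/
theorem conj_forms [IsAlgClosed k] (p : ℕ) [Fact p.Prime] [CharP k p]
    {u : GaRep k 3} (hu : u.IsFundamental) {U : k → Matrix (Fin 3) (Fin 3) k}
    (hU : ∀ t, (u.toFun t : Matrix (Fin 3) (Fin 3) k) = U t) :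
    Conj U (fun _ => 1) ∨ ∃ e, Conj U (stdForm k (p ^ e)) ∨
      ((2 : k) = 0 ∧ (Conj U (symSqForm k (p ^ e)) ∨ Conj U (dualSymSqForm k (p ^ e)))) ∨
      ((2 : k) ≠ 0 ∧ Conj U (oddSymSqForm k (p ^ e))) := by
  obtain rfl : (fun t => (u.toFun t : Matrix (Fin 3) (Fin 3) k)) = U := funext hU
  obtain ⟨α, β, γ, n, m, hm, hc⟩ := conj_unip hu
  have hadd := conj_map_add hc
  have h01 : ∀ s t : k, α * (s + t) ^ n = α * t ^ n + α * s ^ n := fun s t => by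
    simpa [unip, mul_apply, Fin.sum_univ_three] using congrFun (congrFun (hadd s t) 0) 1
  have h12 : ∀ s t : k, γ * (s + t) ^ n = γ * t ^ n + γ * s ^ n := fun s t => by
    simpa [unip, mul_apply, Fin.sum_univ_three] using congrFun (congrFun (hadd s t) 1) 2
  have h02 : ∀ s t : k, β * (s + t) ^ m = β * t ^ m + α * s ^ n * (γ * t ^ n) + β * s ^ m :=
    fun s t => by
      simpa [unip, mul_apply, Fin.sum_univ_three] using congrFun (congrFun (hadd s t) 0) 2
  by_cases hαγ : α = 0 ∧ γ = 0
  · obtain ⟨rfl, rfl⟩ := hαγ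
    rcases eq_or_ne β 0 with rfl | hβ
    · left
      convert hc using 2 with t
      ext i j
      fin_cases i <;> fin_cases j <;> simp [unip]
    · right
      obtain ⟨e, rfl⟩ := eq_prime_pow_of_additive p (n := m) fun s t => by
        have := h02 s t
        refine mul_left_cancel₀ hβ (this.trans ?_)
        ring
      exact ⟨e, Or.inl (hc.trans (conj_unip_stdForm hβ _ _))⟩
  · right
    have hαγ' : α ≠ 0 ∨ γ ≠ 0 := by tauto
    obtain rfl := hm hαγ'
    have hn : ∀ s t : k, (s + t) ^ n = s ^ n + t ^ n := fun s t => by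
      rcases hαγ' with h | h
      · exact mul_left_cancel₀ h ((h01 s t).trans (by ring))
      · exact mul_left_cancel₀ h ((h12 s t).trans (by ring))
    obtain ⟨e, rfl⟩ := eq_prime_pow_of_additive p hn
    refine ⟨e, ?_⟩
    -- At `s = t = 1` the corner entry reads `4β = 2β + αγ`, because `(1 + 1) ^ n = 2`.
    have hβ : 2 * β = α * γ := by
      have h1 := h02 1 1
      have h2 := hn 1 1
      rw [mul_comm 2, pow_mul, h2] at h1
      simp only [one_pow, mul_one] at h1
      linear_combination h1
    by_cases h2 : (2 : k) = 0
    · rw [h2, zero_mul, eq_comm, mul_eq_zero] at hβ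
      rcases hβ with rfl | rfl
      · have hγ : γ ≠ 0 := by tauto
        rcases eq_or_ne β 0 with rfl | hβ
        · exact Or.inl (hc.trans (conj_unip_stdForm_right hγ _ _))
        · exact Or.inr (Or.inl ⟨h2, Or.inr (hc.trans (conj_unip_dualSymSqForm hγ hβ _))⟩)
      · have hα : α ≠ 0 := by tauto
        rcases eq_or_ne β 0 with rfl | hβ
        · exact Or.inl (hc.trans (conj_unip_stdForm_left hα _ _))
        · exact Or.inr (Or.inl ⟨h2, Or.inl (hc.trans (conj_unip_symSqForm hα hβ _))⟩)
    · rcases eq_or_ne α 0 with rfl | hα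
      · have hγ : γ ≠ 0 := by tauto
        obtain rfl : β = 0 := by simpa [h2] using hβ
        exact Or.inl (hc.trans (conj_unip_stdForm_right hγ _ _))
      · rcases eq_or_ne γ 0 with rfl | hγ
        · obtain rfl : β = 0 := by simpa [h2] using hβ
          exact Or.inl (hc.trans (conj_unip_stdForm_left hα _ _))
        · exact Or.inr (Or.inr ⟨h2, hc.trans (conj_unip_oddSymSqForm h2 hα hγ hβ _)⟩)

/-! ### Invariants separating the normal forms -/

theorem Conj.symm {n : ℕ} {M N : k → Matrix (Fin n) (Fin n) k} (h : Conj M N) : Conj N M := by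
  obtain ⟨P, hP⟩ := h
  refine ⟨P⁻¹, fun t => P.isUnit.mul_left_cancel ?_⟩
  rw [← Matrix.mul_assoc, ← hP, Matrix.mul_assoc, Units.mul_inv, Matrix.mul_one,
    Units.mul_inv_cancel_left]

/-- The exponents `d` such that `t ↦ t ^ d` is a linear combination of the entries of `M`. -/
def exponents {n : ℕ} (M : k → Matrix (Fin n) (Fin n) k) : Set ℕ :=
  {d | (fun t : k => t ^ d) ∈
    Submodule.span k (Set.range fun (ij : Fin n × Fin n) (t : k) => M t ij.1 ij.2)}

/-- The entries of `P⁻¹ M P` are constant linear combinations of those of `M`. -/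
theorem Conj.exponents_subset {n : ℕ} {M N : k → Matrix (Fin n) (Fin n) k} (h : Conj M N) :
    exponents N ⊆ exponents M := by
  obtain ⟨P, hP⟩ := h
  intro d hd
  suffices hle : Submodule.span k
      (Set.range fun (ij : Fin n × Fin n) (t : k) => N t ij.1 ij.2) ≤
      Submodule.span k (Set.range fun (ij : Fin n × Fin n) (t : k) => M t ij.1 ij.2) from hle hd
  refine Submodule.span_le.mpr ?_
  rintro _ ⟨⟨i, j⟩, rfl⟩
  have : (fun t => N t i j) = ∑ r, ∑ s, (((P⁻¹ : GL (Fin n) k) : Matrix (Fin n) (Fin n) k) i r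
      * (P : Matrix (Fin n) (Fin n) k) s j) • fun t => M t r s := by
    ext t
    have hN : N t = (P⁻¹ : GL (Fin n) k) * (M t * P) := by
      rw [hP, Units.inv_mul_cancel_left]
    rw [hN]
    simp only [mul_apply, Finset.sum_apply, Pi.smul_apply, smul_eq_mul, Finset.mul_sum]
    refine Finset.sum_congr rfl fun r _ => Finset.sum_congr rfl fun s _ => ?_
    ring
  change (fun t => N t i j) ∈ _
  rw [this]
  exact Submodule.sum_mem _ fun r _ => Submodule.sum_mem _ fun s _ =>
    Submodule.smul_mem _ _ (Submodule.subset_span ⟨(r, s), rfl⟩)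

theorem Conj.exponents_eq {n : ℕ} {M N : k → Matrix (Fin n) (Fin n) k} (h : Conj M N) :
    exponents M = exponents N :=
  Set.Subset.antisymm h.symm.exponents_subset h.exponents_subset

theorem linearIndependent_pow_fun [Infinite k] :
    LinearIndependent k fun (d : ℕ) (t : k) => t ^ d := by
  have := (Polynomial.basisMonomials k).linearIndependent.map'
    (LinearMap.pi fun t : k => Polynomial.leval t) (by
      rw [LinearMap.ker_eq_bot']
      intro f hf
      exact Polynomial.funext fun t => by simpa using congrFun hf t)
  have h : (LinearMap.pi fun t : k => Polynomial.leval t) ∘ Polynomial.basisMonomials k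
      = fun (d : ℕ) (t : k) => t ^ d := by
    ext d t
    simp
  rw [h] at this
  exact this

/-- Under these hypotheses the entries span the same space as the powers `t ^ d` with `d ∈ S`, and
distinct powers are linearly independent. -/
theorem exponents_eq_of_monomial [Infinite k] {n : ℕ} {M : k → Matrix (Fin n) (Fin n) k}
    {S : Set ℕ} (h₁ : ∀ i j, ∃ (c : k) (d : ℕ), d ∈ S ∧ ∀ t, M t i j = c * t ^ d)
    (h₂ : ∀ d ∈ S, ∃ i j, ∃ c : k, ∀ t : k, t ^ d = c * M t i j) : exponents M = S := by
  refine Set.Subset.antisymm (fun d hd => ?_) fun d hd => ?_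
  · by_contra hdS
    suffices hle : Submodule.span k
        (Set.range fun (ij : Fin n × Fin n) (t : k) => M t ij.1 ij.2) ≤
        Submodule.span k ((fun (d : ℕ) (t : k) => t ^ d) '' S) from
      (linearIndependent_pow_fun (k := k)).notMem_span_image hdS (hle hd)
    refine Submodule.span_le.mpr ?_
    rintro _ ⟨⟨i, j⟩, rfl⟩
    obtain ⟨c, d', hd', h⟩ := h₁ i j
    have : (fun t => M t i j) = c • fun t : k => t ^ d' := funext h
    change (fun t => M t i j) ∈ _
    rw [this]
    exact Submodule.smul_mem _ _ (Submodule.subset_span ⟨d', hd', rfl⟩)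
  · obtain ⟨i, j, c, h⟩ := h₂ d hd
    have : (fun t : k => t ^ d) = c • fun t => M t i j := funext h
    change (fun t : k => t ^ d) ∈ Submodule.span k _
    rw [this]
    exact Submodule.smul_mem _ _ (Submodule.subset_span ⟨(i, j), rfl⟩)

theorem exponents_one [Infinite k] :
    exponents (fun _ : k => (1 : Matrix (Fin 3) (Fin 3) k)) = {0} := by
  refine exponents_eq_of_monomial (fun i j => ⟨(1 : Matrix (Fin 3) (Fin 3) k) i j, 0, rfl, by simp⟩) ?_
  rintro d rfl
  exact ⟨0, 0, 1, by simp⟩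

theorem exponents_stdForm [Infinite k] (q : ℕ) : exponents (stdForm k q) = {0, q} := by
  refine exponents_eq_of_monomial (fun i j => ?_) ?_
  · fin_cases i <;> fin_cases j <;> first
      | (refine ⟨1, 0, by simp, fun t => ?_⟩; simp [stdForm]; done)
      | (refine ⟨0, 0, by simp, fun t => ?_⟩; simp [stdForm]; done)
      | (refine ⟨1, q, by simp, fun t => ?_⟩; simp [stdForm])
  · rintro d (rfl | rfl)
    · exact ⟨0, 0, 1, by simp [stdForm]⟩
    · exact ⟨0, 2, 1, by simp [stdForm]⟩

theorem exponents_symSqForm [Infinite k] (q : ℕ) :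
    exponents (symSqForm k q) = {0, q, 2 * q} := by
  refine exponents_eq_of_monomial (fun i j => ?_) ?_
  · fin_cases i <;> fin_cases j <;> first
      | (refine ⟨1, 0, by simp, fun t => ?_⟩; simp [symSqForm]; done)
      | (refine ⟨0, 0, by simp, fun t => ?_⟩; simp [symSqForm]; done)
      | (refine ⟨1, q, by simp, fun t => ?_⟩; simp [symSqForm]; done)
      | (refine ⟨1, 2 * q, by simp, fun t => ?_⟩; simp [symSqForm])
  · rintro d (rfl | rfl | rfl)
    · exact ⟨0, 0, 1, by simp [symSqForm]⟩
    · exact ⟨0, 1, 1, by simp [symSqForm]⟩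
    · exact ⟨0, 2, 1, by simp [symSqForm]⟩

theorem exponents_dualSymSqForm [Infinite k] (q : ℕ) :
    exponents (dualSymSqForm k q) = {0, q, 2 * q} := by
  refine exponents_eq_of_monomial (fun i j => ?_) ?_
  · fin_cases i <;> fin_cases j <;> first
      | (refine ⟨1, 0, by simp, fun t => ?_⟩; simp [dualSymSqForm]; done)
      | (refine ⟨0, 0, by simp, fun t => ?_⟩; simp [dualSymSqForm]; done)
      | (refine ⟨1, q, by simp, fun t => ?_⟩; simp [dualSymSqForm]; done)
      | (refine ⟨1, 2 * q, by simp, fun t => ?_⟩; simp [dualSymSqForm])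
  · rintro d (rfl | rfl | rfl)
    · exact ⟨0, 0, 1, by simp [dualSymSqForm]⟩
    · exact ⟨1, 2, 1, by simp [dualSymSqForm]⟩
    · exact ⟨0, 2, 1, by simp [dualSymSqForm]⟩

theorem exponents_oddSymSqForm [Infinite k] (h2 : (2 : k) ≠ 0) (q : ℕ) :
    exponents (oddSymSqForm k q) = {0, q, 2 * q} := by
  refine exponents_eq_of_monomial (fun i j => ?_) ?_
  · fin_cases i <;> fin_cases j <;> first
      | (refine ⟨1, 0, by simp, fun t => ?_⟩; simp [oddSymSqForm]; done)
      | (refine ⟨0, 0, by simp, fun t => ?_⟩; simp [oddSymSqForm]; done)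
      | (refine ⟨1, q, by simp, fun t => ?_⟩; simp [oddSymSqForm]; done)
      | (refine ⟨1 / 2, 2 * q, by simp, fun t => ?_⟩; simp [oddSymSqForm])
  · rintro d (rfl | rfl | rfl)
    · exact ⟨0, 0, 1, by simp [oddSymSqForm]⟩
    · exact ⟨0, 1, 1, by simp [oddSymSqForm]⟩
    · exact ⟨0, 2, 2, by simp [oddSymSqForm, h2]⟩

theorem insert_pair_inj {q r : ℕ} (hq : 0 < q) (h : ({0, q} : Set ℕ) = {0, r}) : q = r := by
  have h1 : q ∈ ({0, r} : Set ℕ) := by simp [← h]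
  simp only [Set.mem_insert_iff, Set.mem_singleton_iff] at h1
  omega

theorem insert_double_inj {q r : ℕ} (hq : 0 < q) (hr : 0 < r)
    (h : ({0, q, 2 * q} : Set ℕ) = {0, r, 2 * r}) : q = r := by
  have h1 : q ∈ ({0, r, 2 * r} : Set ℕ) := by simp [← h]
  have h2 : r ∈ ({0, q, 2 * q} : Set ℕ) := by simp [h]
  simp only [Set.mem_insert_iff, Set.mem_singleton_iff] at h1 h2
  omega

theorem pair_ne_double {q r : ℕ} (hr : 0 < r) : ({0, q} : Set ℕ) ≠ {0, r, 2 * r} := by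
  intro h
  have h1 : r ∈ ({0, q} : Set ℕ) := by simp [h]
  have h2 : 2 * r ∈ ({0, q} : Set ℕ) := by simp [h]
  simp only [Set.mem_insert_iff, Set.mem_singleton_iff] at h1 h2
  omega

theorem singleton_ne_insert {q : ℕ} (hq : 0 < q) {S : Set ℕ} (hS : q ∈ S) : ({0} : Set ℕ) ≠ S := by
  rintro rfl
  rw [Set.mem_singleton_iff] at hS
  omega

/-- An intertwiner `P` carries fixed row vectors to fixed row vectors. The symmetric square form
fixes the last two coordinate rows, the dual form only multiples of the last, so two rows of `P`
would be proportional. -/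
theorem not_conj_symSqForm_dualSymSqForm [Infinite k] {q : ℕ} (hq : 0 < q) :
    ¬ Conj (symSqForm k q) (dualSymSqForm k q) := by
  rintro ⟨P, hP⟩
  have hdet : (P : Matrix (Fin 3) (Fin 3) k).det ≠ 0 :=
    ((Matrix.isUnit_iff_isUnit_det _).mp P.isUnit).ne_zero
  have aux : ∀ a b : k, (∀ t : k, a * t ^ (2 * q) + b * t ^ q = 0) → a = 0 ∧ b = 0 := by
    intro a b h
    have hf : (Polynomial.C a * Polynomial.X ^ (2 * q) + Polynomial.C b * Polynomial.X ^ q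
        : Polynomial k) = 0 := Polynomial.funext fun t => by simpa using h t
    have h1 := congrArg (fun f => Polynomial.coeff f (2 * q)) hf
    have h2 := congrArg (fun f => Polynomial.coeff f q) hf
    simp only [Polynomial.coeff_add, Polynomial.coeff_C_mul, Polynomial.coeff_X_pow,
      Polynomial.coeff_zero] at h1 h2
    rw [if_neg (show ¬ 2 * q = q by omega)] at h1
    rw [if_neg (show ¬ q = 2 * q by omega)] at h2
    exact ⟨by simpa using h1, by simpa using h2⟩
  have h1 := aux (P 1 0) (P 1 1) fun t => by
    simpa [symSqForm, dualSymSqForm, mul_apply, Fin.sum_univ_three] using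
      congrFun (congrFun (hP t) 1) 2
  have h2 := aux (P 2 0) (P 2 1) fun t => by
    simpa [symSqForm, dualSymSqForm, mul_apply, Fin.sum_univ_three] using
      congrFun (congrFun (hP t) 2) 2
  apply hdet
  rw [det_fin_three, h1.1, h1.2, h2.1, h2.2]
  ring

theorem fundamentalClass_eq_iff {n : ℕ} {u v : FundamentalGaRep k n}
    {M N : k → Matrix (Fin n) (Fin n) k} (hu : HasForm u M) (hv : HasForm v N) :
    fundamentalClass u = fundamentalClass v ↔ Conj M N := by
  obtain rfl : (fun t => (u.1.toFun t : Matrix (Fin n) (Fin n) k)) = M := funext hu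
  obtain rfl : (fun t => (v.1.toFun t : Matrix (Fin n) (Fin n) k)) = N := funext hv
  rw [← equivalent_iff_conj]
  exact Quotient.eq (r := fundamentalSetoid k n)

/-- A system of representatives for a type of classes yields the correspondence. -/
theorem exists_equiv_of_bijective {α β : Type*} {g : β → α} (hg : Function.Bijective g) :
    ∃ Φ : α ≃ β, ∀ b, Φ (g b) = b :=
  ⟨(Equiv.ofBijective g hg).symm, fun b => (Equiv.ofBijective g hg).symm_apply_apply b⟩

end Classification

end GaSL

/-! ### Assembly of the correspondences -/

open GaSL in
theorem corollary4p2 {k : Type*} [Field k] [IsAlgClosed k] (p : ℕ) [Fact p.Prime] [CharP k p] :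
    (p = 2 →
      ∃ Φ : GaSL.FundamentalClasses k 3 ≃ ℕ ⊕ ℕ ⊕ ℕ ⊕ GaSL.OnlyId k 3,
        (∀ e : ℕ, ∃ u : GaSL.FundamentalGaRep k 3,
          GaSL.HasForm u (fun t => !![1, 0, t ^ p ^ e; 0, 1, 0; 0, 0, 1]) ∧
          Φ (GaSL.fundamentalClass u) = Sum.inl e) ∧
        (∀ e : ℕ, ∃ u : GaSL.FundamentalGaRep k 3,
          GaSL.HasForm u (fun t => !![1, t ^ p ^ e, t ^ (2 * p ^ e); 0, 1, 0; 0, 0, 1]) ∧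
          Φ (GaSL.fundamentalClass u) = Sum.inr (Sum.inl e)) ∧
        (∀ e : ℕ, ∃ u : GaSL.FundamentalGaRep k 3,
          GaSL.HasForm u (fun t => !![1, 0, t ^ (2 * p ^ e); 0, 1, t ^ p ^ e; 0, 0, 1]) ∧
          Φ (GaSL.fundamentalClass u) = Sum.inr (Sum.inr (Sum.inl e))) ∧
        (∃ u : GaSL.FundamentalGaRep k 3,
          GaSL.HasForm u (fun _ => 1) ∧
          Φ (GaSL.fundamentalClass u) = Sum.inr (Sum.inr (Sum.inr ⟨1, rfl⟩)))) ∧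
    (3 ≤ p →
      ∃ Φ : GaSL.FundamentalClasses k 3 ≃ ℕ ⊕ ℕ ⊕ GaSL.OnlyId k 3,
        (∀ e : ℕ, ∃ u : GaSL.FundamentalGaRep k 3,
          GaSL.HasForm u
            (fun t => !![1, t ^ p ^ e, (1 / 2 : k) * t ^ (2 * p ^ e); 0, 1, t ^ p ^ e; 0, 0, 1]) ∧
          Φ (GaSL.fundamentalClass u) = Sum.inl e) ∧
        (∀ e : ℕ, ∃ u : GaSL.FundamentalGaRep k 3,
          GaSL.HasForm u (fun t => !![1, 0, t ^ p ^ e; 0, 1, 0; 0, 0, 1]) ∧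
          Φ (GaSL.fundamentalClass u) = Sum.inr (Sum.inl e)) ∧
        (∃ u : GaSL.FundamentalGaRep k 3,
          GaSL.HasForm u (fun _ => 1) ∧
          Φ (GaSL.fundamentalClass u) = Sum.inr (Sum.inr ⟨1, rfl⟩))) := by
  have hp : p.Prime := Fact.out
  have : ExpChar k p := ExpChar.prime hp
  have : Infinite k := IsAlgClosed.instInfinite
  have hpos : ∀ e, 0 < p ^ e := fun e => pow_pos hp.pos e
  have hpinj : ∀ {e e' : ℕ}, p ^ e = p ^ e' → e = e' := fun h =>
    Nat.pow_right_injective hp.two_le h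
  have fstd : ∀ e, HasForm ((stdRep k).twist p e).fundamental (stdForm k (p ^ e)) :=
    stdRep_hasForm p
  have fone : HasForm (trivialRep k 3).fundamental (fun _ => 1) := trivialRep_hasForm
  have std_inj : ∀ {e e'}, Conj (stdForm k (p ^ e)) (stdForm k (p ^ e')) → e = e' := fun h => by
    have := h.exponents_eq
    rw [exponents_stdForm, exponents_stdForm] at this
    exact hpinj (insert_pair_inj (hpos _) this)
  have std_one : ∀ {e}, ¬ Conj (fun _ => 1) (stdForm k (p ^ e)) := fun {e} h => by
    have := h.exponents_eq
    rw [exponents_one, exponents_stdForm] at this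
    exact singleton_ne_insert (hpos e) (by simp) this
  refine ⟨fun h2 => ?_, fun h3 => ?_⟩
  · have two : (2 : k) = 0 := by
      have := CharP.cast_eq_zero k p
      rw [h2] at this
      exact_mod_cast this
    have fsym : ∀ e, HasForm ((symSqRep k two).twist p e).fundamental (symSqForm k (p ^ e)) :=
      fun e => symSqRep_hasForm p e two
    have fdual : ∀ e, HasForm ((dualSymSqRep k two).twist p e).fundamental
        (dualSymSqForm k (p ^ e)) := fun e => dualSymSqRep_hasForm p e two
    have std_sym : ∀ {e e'}, ¬ Conj (stdForm k (p ^ e)) (symSqForm k (p ^ e')) := fun h => by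
      have := h.exponents_eq
      rw [exponents_stdForm, exponents_symSqForm] at this
      exact pair_ne_double (hpos _) this
    have std_dual : ∀ {e e'}, ¬ Conj (stdForm k (p ^ e)) (dualSymSqForm k (p ^ e')) := fun h => by
      have := h.exponents_eq
      rw [exponents_stdForm, exponents_dualSymSqForm] at this
      exact pair_ne_double (hpos _) this
    have sym_inj : ∀ {e e'}, Conj (symSqForm k (p ^ e)) (symSqForm k (p ^ e')) → e = e' :=
      fun h => by
        have := h.exponents_eq
        rw [exponents_symSqForm, exponents_symSqForm] at this
        exact hpinj (insert_double_inj (hpos _) (hpos _) this)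
    have dual_inj : ∀ {e e'}, Conj (dualSymSqForm k (p ^ e)) (dualSymSqForm k (p ^ e')) →
        e = e' := fun h => by
      have := h.exponents_eq
      rw [exponents_dualSymSqForm, exponents_dualSymSqForm] at this
      exact hpinj (insert_double_inj (hpos _) (hpos _) this)
    have sym_dual : ∀ {e e'}, ¬ Conj (symSqForm k (p ^ e)) (dualSymSqForm k (p ^ e')) :=
      fun h => by
        have := h.exponents_eq
        rw [exponents_symSqForm, exponents_dualSymSqForm] at this
        -- The exponents only force equal twists here; the fixed rows then give the contradiction.
        rw [insert_double_inj (hpos _) (hpos _) this] at h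
        exact not_conj_symSqForm_dualSymSqForm (hpos _) h
    have sym_one : ∀ {e}, ¬ Conj (fun _ => 1) (symSqForm k (p ^ e)) := fun {e} h => by
      have := h.exponents_eq
      rw [exponents_one, exponents_symSqForm] at this
      exact singleton_ne_insert (hpos e) (by simp) this
    have dual_one : ∀ {e}, ¬ Conj (fun _ => 1) (dualSymSqForm k (p ^ e)) := fun {e} h => by
      have := h.exponents_eq
      rw [exponents_one, exponents_dualSymSqForm] at this
      exact singleton_ne_insert (hpos e) (by simp) this
    -- This is the inverse of the required `Φ`: injective by the invariants, surjective by
    -- `conj_forms`.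
    let g : ℕ ⊕ ℕ ⊕ ℕ ⊕ OnlyId k 3 → FundamentalClasses k 3 :=
      Sum.elim (fun e => fundamentalClass ((stdRep k).twist p e).fundamental)
        (Sum.elim (fun e => fundamentalClass ((symSqRep k two).twist p e).fundamental)
          (Sum.elim (fun e => fundamentalClass ((dualSymSqRep k two).twist p e).fundamental)
            (fun _ => fundamentalClass (trivialRep k 3).fundamental)))
    have hg : Function.Bijective g := by
      constructor
      · rintro (e | e | e | ⟨_, rfl⟩) (e' | e' | e' | ⟨_, rfl⟩) h
        · rw [std_inj ((fundamentalClass_eq_iff (fstd e) (fstd e')).mp h)]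
        · exact (std_sym ((fundamentalClass_eq_iff (fstd e) (fsym e')).mp h)).elim
        · exact (std_dual ((fundamentalClass_eq_iff (fstd e) (fdual e')).mp h)).elim
        · exact (std_one ((fundamentalClass_eq_iff (fstd e) fone).mp h).symm).elim
        · exact (std_sym ((fundamentalClass_eq_iff (fsym e) (fstd e')).mp h).symm).elim
        · rw [sym_inj ((fundamentalClass_eq_iff (fsym e) (fsym e')).mp h)]
        · exact (sym_dual ((fundamentalClass_eq_iff (fsym e) (fdual e')).mp h)).elim
        · exact (sym_one ((fundamentalClass_eq_iff (fsym e) fone).mp h).symm).elim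
        · exact (std_dual ((fundamentalClass_eq_iff (fdual e) (fstd e')).mp h).symm).elim
        · exact (sym_dual ((fundamentalClass_eq_iff (fdual e) (fsym e')).mp h).symm).elim
        · rw [dual_inj ((fundamentalClass_eq_iff (fdual e) (fdual e')).mp h)]
        · exact (dual_one ((fundamentalClass_eq_iff (fdual e) fone).mp h).symm).elim
        · exact (std_one ((fundamentalClass_eq_iff fone (fstd e')).mp h)).elim
        · exact (sym_one ((fundamentalClass_eq_iff fone (fsym e')).mp h)).elim
        · exact (dual_one ((fundamentalClass_eq_iff fone (fdual e')).mp h)).elim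
        · rfl
      · refine Quotient.ind fun u => ?_
        have hu : HasForm u _ := fun _ => rfl
        rcases conj_forms p u.2 hu with h | ⟨e, h | ⟨-, h | h⟩ | ⟨h, -⟩⟩
        · exact ⟨Sum.inr (Sum.inr (Sum.inr ⟨1, rfl⟩)),
            (fundamentalClass_eq_iff fone hu).mpr h.symm⟩
        · exact ⟨Sum.inl e, (fundamentalClass_eq_iff (fstd e) hu).mpr h.symm⟩
        · exact ⟨Sum.inr (Sum.inl e), (fundamentalClass_eq_iff (fsym e) hu).mpr h.symm⟩
        · exact ⟨Sum.inr (Sum.inr (Sum.inl e)),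
            (fundamentalClass_eq_iff (fdual e) hu).mpr h.symm⟩
        · exact (h two).elim
    obtain ⟨Φ, hΦ⟩ := exists_equiv_of_bijective hg
    exact ⟨Φ, fun e => ⟨_, fstd e, hΦ (Sum.inl e)⟩,
      fun e => ⟨_, fsym e, hΦ (Sum.inr (Sum.inl e))⟩,
      fun e => ⟨_, fdual e, hΦ (Sum.inr (Sum.inr (Sum.inl e)))⟩,
      ⟨_, fone, hΦ (Sum.inr (Sum.inr (Sum.inr ⟨1, rfl⟩)))⟩⟩
  · have two : (2 : k) ≠ 0 := by
      intro h
      have h' : ((2 : ℕ) : k) = 0 := by exact_mod_cast h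
      rw [CharP.cast_eq_zero_iff k p] at h'
      have := Nat.le_of_dvd two_pos h'
      omega
    have fodd : ∀ e, HasForm ((oddSymSqRep k two).twist p e).fundamental
        (oddSymSqForm k (p ^ e)) := fun e => oddSymSqRep_hasForm p e two
    have std_odd : ∀ {e e'}, ¬ Conj (stdForm k (p ^ e)) (oddSymSqForm k (p ^ e')) := fun h => by
      have := h.exponents_eq
      rw [exponents_stdForm, exponents_oddSymSqForm two] at this
      exact pair_ne_double (hpos _) this
    have odd_inj : ∀ {e e'}, Conj (oddSymSqForm k (p ^ e)) (oddSymSqForm k (p ^ e')) → e = e' :=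
      fun h => by
        have := h.exponents_eq
        rw [exponents_oddSymSqForm two, exponents_oddSymSqForm two] at this
        exact hpinj (insert_double_inj (hpos _) (hpos _) this)
    have odd_one : ∀ {e}, ¬ Conj (fun _ => 1) (oddSymSqForm k (p ^ e)) := fun {e} h => by
      have := h.exponents_eq
      rw [exponents_one, exponents_oddSymSqForm two] at this
      exact singleton_ne_insert (hpos e) (by simp) this
    let g : ℕ ⊕ ℕ ⊕ OnlyId k 3 → FundamentalClasses k 3 :=
      Sum.elim (fun e => fundamentalClass ((oddSymSqRep k two).twist p e).fundamental)
        (Sum.elim (fun e => fundamentalClass ((stdRep k).twist p e).fundamental)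
          (fun _ => fundamentalClass (trivialRep k 3).fundamental))
    have hg : Function.Bijective g := by
      constructor
      · rintro (e | e | ⟨_, rfl⟩) (e' | e' | ⟨_, rfl⟩) h
        · rw [odd_inj ((fundamentalClass_eq_iff (fodd e) (fodd e')).mp h)]
        · exact (std_odd ((fundamentalClass_eq_iff (fodd e) (fstd e')).mp h).symm).elim
        · exact (odd_one ((fundamentalClass_eq_iff (fodd e) fone).mp h).symm).elim
        · exact (std_odd ((fundamentalClass_eq_iff (fstd e) (fodd e')).mp h)).elim
        · rw [std_inj ((fundamentalClass_eq_iff (fstd e) (fstd e')).mp h)]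
        · exact (std_one ((fundamentalClass_eq_iff (fstd e) fone).mp h).symm).elim
        · exact (odd_one ((fundamentalClass_eq_iff fone (fodd e')).mp h)).elim
        · exact (std_one ((fundamentalClass_eq_iff fone (fstd e')).mp h)).elim
        · rfl
      · refine Quotient.ind fun u => ?_
        have hu : HasForm u _ := fun _ => rfl
        rcases conj_forms p u.2 hu with h | ⟨e, h | ⟨h, -⟩ | ⟨-, h⟩⟩
        · exact ⟨Sum.inr (Sum.inr ⟨1, rfl⟩), (fundamentalClass_eq_iff fone hu).mpr h.symm⟩
        · exact ⟨Sum.inr (Sum.inl e), (fundamentalClass_eq_iff (fstd e) hu).mpr h.symm⟩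
        · exact (two h).elim
        · exact ⟨Sum.inl e, (fundamentalClass_eq_iff (fodd e) hu).mpr h.symm⟩
    obtain ⟨Φ, hΦ⟩ := exists_equiv_of_bijective hg
    exact ⟨Φ, fun e => ⟨_, fodd e, hΦ (Sum.inl e)⟩,
      fun e => ⟨_, fstd e, hΦ (Sum.inr (Sum.inl e))⟩,
      ⟨_, fone, hΦ (Sum.inr (Sum.inr ⟨1, rfl⟩))⟩⟩
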